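/- Let $X$ be a real Banach space with a Schauder basis $(e_i)_{i\in\mathbb N}$ (with coefficient functionals $e_i^*$) that is - pre-monotone: $\|x-\sum_{i=1}^n e_i^*(x)e_i\|\le\|x\|$ for all $x\in X$ and $n\in\mathbb N$; and - unconditional: there is $D\ge 1$ such that $\|\sum_{i=1}^n\epsilon_i c_i e_i\|\le D\,\|\sum_{i=1}^n c_i e_i\|$ for all $n$, all scalars $c_1,\dots,c_n\in\mathbb R$ and all signs $\epsilon_1,\dots,\epsilon_n\in\{-1,1\}$. Say that a nonempty closed bounded convex set $C\subseteq X$ has the fixed point property (FPP) for affine nonexpansive mappings if every map $T\colon C\to C$ satisfying $\|Tx-Ty\|\le\|x-y\|$ and $T(\lambda x+(1-\lambda)y)=\lambda Tx+(1-\lambda)Ty$ for all $x,y\in C$ and $\lambda\in[0,1]$ has a fixed point; and that $X$ has the FPP for affine nonexpansive mappings if every nonempty closed bounded convex subset of $X$ has it. If no subspace of $X$ is linearly isomorphic to $\ell_1$, then the following are equivalent: (i) $X$ is reflexive. (ii) $X$ has the FPP for affine nonexpansive mappings. (iii) Every nonempty closed convex subset of the closed unit ball $B_X=\{x\in X:\|x\|\le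 1\}$ has the FPP for affine nonexpansive mappings. -/

import Mathlib

/-- The `n`-th tail operator `R_n = I - P_n` of a Schauder basis, where
`P_n x = ∑ i < n, e*_i(x) e_i` is the `n`-th partial sum projection. -/
noncomputable def SchauderBasis.tailProj {X : Type*} [NormedAddCommGroup X] [NormedSpace ℝ X]
    (b : SchauderBasis ℝ X) (n : ℕ) : X →L[ℝ] X :=
  ContinuousLinearMap.id ℝ X - b.proj n

/-- A Schauder basis is pre-monotone if `‖R_n x‖ ≤ ‖x‖` for all `x` and `n`. -/
def SchauderBasis.IsPremonotone {X : Type*} [NormedAddCommGroup X] [NormedSpace ℝ X]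
    (b : SchauderBasis ℝ X) : Prop :=
  ∀ (n : ℕ) (x : X), ‖b.tailProj n x‖ ≤ ‖x‖

/-- A Schauder basis is unconditional if it is `D`-unconditional for some `D ≥ 1`:
`‖∑ ε_i c_i e_i‖ ≤ D ‖∑ c_i e_i‖` for all finitely many scalars `c_i` and signs `ε_i`. -/
def SchauderBasis.IsUnconditional {X : Type*} [NormedAddCommGroup X] [NormedSpace ℝ X]
    (b : SchauderBasis ℝ X) : Prop :=
  ∃ D : ℝ, 1 ≤ D ∧ ∀ (n : ℕ) (c ε : ℕ → ℝ), (∀ i, ε i = 1 ∨ ε i = -1) →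
    ‖∑ i ∈ Finset.range n, (ε i * c i) • b i‖ ≤ D * ‖∑ i ∈ Finset.range n, c i • b i‖

/-- `X` contains no subspace linearly isomorphic (as a topological vector space) to `ℓ₁`. -/
def ContainsNoCopyOfEllOne (X : Type*) [NormedAddCommGroup X] [NormedSpace ℝ X] : Prop :=
  ∀ S : Submodule ℝ X, IsEmpty (S ≃L[ℝ] lp (fun _ : ℕ => ℝ) 1)

/-- `X` is reflexive: the canonical embedding into the bidual is onto. -/
def IsReflexiveSpace (X : Type*) [NormedAddCommGroup X] [NormedSpace ℝ X] : Prop :=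
  Function.Surjective (NormedSpace.inclusionInDoubleDual ℝ X)

/-- `T` is affine on the (convex) set `C`. -/
def IsAffineOn {X : Type*} [NormedAddCommGroup X] [NormedSpace ℝ X]
    (T : X → X) (C : Set X) : Prop :=
  ∀ x ∈ C, ∀ y ∈ C, ∀ t ∈ Set.Icc (0 : ℝ) 1,
    T (t • x + (1 - t) • y) = t • T x + (1 - t) • T y

/-- The set `C` has the fixed point property for affine nonexpansive mappings: every affine
nonexpansive (1-Lipschitz) map `C → C` has a fixed point. A map `C → C` is represented by a map on
`X` that sends `C` into `C`; its values off `C` play no role. -/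
def HasAffineFPP {X : Type*} [NormedAddCommGroup X] [NormedSpace ℝ X] (C : Set X) : Prop :=
  ∀ T : X → X, Set.MapsTo T C C → LipschitzOnWith 1 T C → IsAffineOn T C → ∃ x ∈ C, T x = x

/-- The space `X` has the fixed point property for affine nonexpansive mappings: every nonempty
closed bounded convex subset has it. -/
def SpaceHasAffineFPP (X : Type*) [NormedAddCommGroup X] [NormedSpace ℝ X] : Prop :=
  ∀ C : Set X, C.Nonempty → IsClosed C → Bornology.IsBounded C → Convex ℝ C → HasAffineFPP C

/-! Reflexivity gives fixed points by weak compactness: for affine `T` the approximate fixed point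
sets are nested, closed and convex, so they share a point. The converse follows James: a shrinking
and boundedly complete basis forces reflexivity. Absence of `ℓ₁` makes the unconditional basis
shrinking (`tendsto_comp_tailProj`). Bounded completeness comes from the FPP (`exists_coord_eq`): if
the partial sums of `a i • b i` are bounded, the map replacing `x i` by `(1 - 2⁻⁽ⁱ⁺¹⁾) x i + 2⁻⁽ⁱ⁺¹⁾
a i` preserves an order interval, and a fixed point must have coordinates `a i`. Its linear part is
an average of tail projections, hence nonexpansive by premonotonicity. -/

open Filter Topology

/-! ### Fixed points in reflexive spaces -/

section Reflexive

variable {X : Type*} [NormedAddCommGroup X] [NormedSpace ℝ X]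

/-- In a reflexive space, a decreasing sequence of nonempty closed bounded convex sets has a
common point. -/
theorem IsReflexiveSpace.exists_mem_iInter (h : IsReflexiveSpace X) {F : ℕ → Set X}
    (hF : Antitone F) (hne : ∀ n, (F n).Nonempty) (hcl : ∀ n, IsClosed (F n))
    (hcv : ∀ n, Convex ℝ (F n)) (hb : Bornology.IsBounded (F 0)) : ∃ y, ∀ n, y ∈ F n := by
  choose y hy using hne
  obtain ⟨R, hR⟩ := hb.exists_norm_le
  let j : ℕ → WeakDual ℝ (StrongDual ℝ X) := fun n ↦
    StrongDual.toWeakDual (NormedSpace.inclusionInDoubleDual ℝ X (y n))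
  have hK := WeakDual.isCompact_closedBall (𝕜 := ℝ) (0 : StrongDual ℝ (StrongDual ℝ X)) R
  have hj : ∀ n, j n ∈ WeakDual.toStrongDual ⁻¹' Metric.closedBall
      (0 : StrongDual ℝ (StrongDual ℝ X)) R := fun n ↦ by
    refine (mem_closedBall_zero_iff (a := NormedSpace.inclusionInDoubleDual ℝ X (y n))).2 ?_
    exact (NormedSpace.double_dual_bound ℝ X (y n)).trans (hR _ (hF (Nat.zero_le n) (hy n)))
  obtain ⟨φ, -, hφ⟩ := hK.exists_mapClusterPt (f := atTop) (u := j)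
    (tendsto_principal.2 (Eventually.of_forall hj))
  obtain ⟨z, hz⟩ := h (WeakDual.toStrongDual φ)
  refine ⟨z, fun n ↦ by_contra fun hzn ↦ ?_⟩
  -- A weak-* cluster point outside `F n` is separated from it by some `f`, yet `y m ∈ F n` for all
  -- `m ≥ n`.
  obtain ⟨f, u, hfu, huz⟩ := geometric_hahn_banach_closed_point (hcv n) (hcl n) hzn
  have hev : Continuous fun ψ : WeakDual ℝ (StrongDual ℝ X) ↦ ψ f := WeakDual.eval_continuous f
  have hφf : φ f = f z := by
    have := congrArg (fun ψ ↦ ψ f) hz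
    simpa using this.symm
  have hopen : {ψ : WeakDual ℝ (StrongDual ℝ X) | u < ψ f} ∈ 𝓝 φ :=
    (isOpen_lt continuous_const hev).mem_nhds (by simpa [hφf] using huz)
  obtain ⟨m, hm, hnm⟩ :=
    ((mapClusterPt_iff_frequently.1 hφ _ hopen).and_eventually (eventually_ge_atTop n)).exists
  have h1 : u < f (y m) := hm
  exact lt_asymm h1 (hfu _ (hF hnm (hy m)))

/-- A nonexpansive self-map of a bounded complete convex set has approximate fixed points. -/
theorem LipschitzOnWith.exists_norm_sub_le {C : Set X} {T : X → X} (hT : LipschitzOnWith 1 T C)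
    (hm : Set.MapsTo T C C) (hne : C.Nonempty) (hc : IsComplete C) (hb : Bornology.IsBounded C)
    (hcv : Convex ℝ C) {ε : ℝ} (hε : 0 < ε) : ∃ y ∈ C, ‖T y - y‖ ≤ ε := by
  obtain ⟨x, hx⟩ := hne
  obtain ⟨R, hR⟩ := hb.exists_norm_le
  have hR0 : 0 ≤ R := (norm_nonneg x).trans (hR x hx)
  obtain ⟨s, hs0, hs1, hsR⟩ : ∃ s : ℝ, 0 < s ∧ s ≤ 1 ∧ s * (2 * R) ≤ ε := by
    refine ⟨min 1 (ε / (2 * R + 1)), by positivity, min_le_left _ _, ?_⟩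
    calc min 1 (ε / (2 * R + 1)) * (2 * R) ≤ ε / (2 * R + 1) * (2 * R + 1) := by
          gcongr
          · exact min_le_right _ _
          · linarith
      _ = ε := by field_simp
  -- Damping `T` towards `x` gives a strict contraction; its fixed point is moved by `T` by `s * ‖T
  -- y - x‖`.
  let S : X → X := fun y ↦ s • x + (1 - s) • T y
  have hS : Set.MapsTo S C C := fun y hy ↦ hcv hx (hm hy) hs0.le (by linarith) (by ring)
  have hcon : ContractingWith (1 - s).toNNReal (hS.restrict S C C) := by
    refine ⟨?_, LipschitzWith.of_dist_le_mul fun p q ↦ ?_⟩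
    · rw [← NNReal.coe_lt_coe, Real.coe_toNNReal _ (by linarith)]
      simpa using hs0
    · have h1 := hT.dist_le_mul p p.2 q q.2
      rw [Real.coe_toNNReal _ (by linarith), Subtype.dist_eq, Subtype.dist_eq]
      simp only [Set.MapsTo.val_restrict_apply, S, dist_add_left, dist_smul₀, Real.norm_eq_abs,
        abs_of_nonneg (show 0 ≤ 1 - s by linarith)]
      exact mul_le_mul_of_nonneg_left (by simpa using h1) (by linarith)
  obtain ⟨y, hy, hfix, -⟩ := hcon.exists_fixedPoint' hc hS hx (edist_ne_top _ _)
  refine ⟨y, hy, ?_⟩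
  have h2 : T y - y = s • (T y - x) := by
    have h3 : s • x + (1 - s) • T y = y := hfix
    nth_rewrite 2 [← h3]
    module
  rw [h2, norm_smul, Real.norm_of_nonneg hs0.le]
  calc s * ‖T y - x‖ ≤ s * (2 * R) := by
        gcongr
        linarith [_root_.norm_sub_le (T y) x, hR _ (hm hy), hR _ hx]
    _ ≤ ε := hsR

theorem IsReflexiveSpace.spaceHasAffineFPP [CompleteSpace X] (h : IsReflexiveSpace X) :
    SpaceHasAffineFPP X := by
  intro C hne hcl hb hcv T hm hT haff
  let F : ℕ → Set X := fun n ↦ {y ∈ C | ‖T y - y‖ ≤ 1 / ((n : ℝ) + 1)}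
  obtain ⟨z, hz⟩ := h.exists_mem_iInter (F := F)
    (fun m n hmn y hy ↦ ⟨hy.1, hy.2.trans (one_div_le_one_div_of_le (by positivity)
      (by gcongr))⟩)
    (fun n ↦ hT.exists_norm_sub_le hm hne hcl.isComplete hb hcv (by positivity))
    (fun n ↦ (hT.continuousOn.sub continuousOn_id).norm.preimage_isClosed_of_isClosed hcl
      isClosed_Iic)
    (fun n x hx y hy s t hs ht hst ↦ by
      refine ⟨hcv hx.1 hy.1 hs ht hst, ?_⟩
      obtain rfl : t = 1 - s := by linarith
      rw [haff x hx.1 y hy.1 s ⟨hs, by linarith⟩]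
      calc ‖s • T x + (1 - s) • T y - (s • x + (1 - s) • y)‖
          = ‖s • (T x - x) + (1 - s) • (T y - y)‖ := by congr 1; module
        _ ≤ s * ‖T x - x‖ + (1 - s) * ‖T y - y‖ := by
          refine (norm_add_le _ _).trans_eq ?_
          rw [norm_smul, norm_smul, Real.norm_of_nonneg hs, Real.norm_of_nonneg ht]
        _ ≤ s * (1 / ((n : ℝ) + 1)) + (1 - s) * (1 / ((n : ℝ) + 1)) :=
          add_le_add (mul_le_mul_of_nonneg_left hx.2 hs) (mul_le_mul_of_nonneg_left hy.2 ht)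
        _ = 1 / ((n : ℝ) + 1) := by ring)
    (hb.subset fun y hy ↦ hy.1)
  refine ⟨z, (hz 0).1, ?_⟩
  have h0 : ‖T z - z‖ ≤ 0 :=
    ge_of_tendsto' tendsto_one_div_add_atTop_nhds_zero_nat fun n ↦ (hz n).2
  exact sub_eq_zero.1 (norm_le_zero_iff.1 h0)

end Reflexive

/-! ### Coordinates and unconditionality -/

namespace SchauderBasis

variable {X : Type*} [NormedAddCommGroup X] [NormedSpace ℝ X] (b : SchauderBasis ℝ X)

theorem coord_basis (i j : ℕ) : b.coord i (b j) = if i = j then 1 else 0 := by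
  rw [b.ortho]
  simp [Pi.single_apply]

theorem tailProj_apply (n : ℕ) (x : X) : b.tailProj n x = x - b.proj n x := rfl

theorem coord_proj (i n : ℕ) (x : X) :
    b.coord i (b.proj n x) = if i < n then b.coord i x else 0 := by
  simp [coord_basis]

theorem coord_tailProj (i n : ℕ) (x : X) :
    b.coord i (b.tailProj n x) = if i < n then 0 else b.coord i x := by
  rw [tailProj_apply, map_sub, coord_proj]
  split_ifs <;> simp

variable {b}

theorem norm_le_of_norm_proj_le {x : X} {K : ℝ} (h : ∀ n, ‖b.proj n x‖ ≤ K) : ‖x‖ ≤ K :=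
  le_of_tendsto' (b.tendsto_proj x).norm h

theorem IsPremonotone.norm_tailProj_le (h : b.IsPremonotone) (n : ℕ) : ‖b.tailProj n‖ ≤ 1 :=
  ContinuousLinearMap.opNorm_le_bound _ zero_le_one fun x ↦ by simpa using h n x

theorem IsPremonotone.norm_proj_apply_le (h : b.IsPremonotone) (n : ℕ) (x : X) :
    ‖b.proj n x‖ ≤ 2 * ‖x‖ := by
  have h1 : b.proj n x = x - b.tailProj n x := by rw [tailProj_apply]; abel
  rw [h1]
  linarith [norm_sub_le x (b.tailProj n x), h n x]

/-- Vectors whose coordinates agree up to sign have comparable norms. -/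
theorem norm_le_of_abs_coord_eq {D : ℝ}
    (hD : ∀ (n : ℕ) (c ε : ℕ → ℝ), (∀ i, ε i = 1 ∨ ε i = -1) →
      ‖∑ i ∈ Finset.range n, (ε i * c i) • b i‖ ≤ D * ‖∑ i ∈ Finset.range n, c i • b i‖)
    {v w : X} (h : ∀ i, |b.coord i w| = |b.coord i v|) : ‖w‖ ≤ D * ‖v‖ := by
  have hε : ∀ i, ∃ ε : ℝ, (ε = 1 ∨ ε = -1) ∧ b.coord i w = ε * b.coord i v := fun i ↦ by
    rcases abs_eq_abs.1 (h i) with h | h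
    · exact ⟨1, Or.inl rfl, by simpa using h⟩
    · exact ⟨-1, Or.inr rfl, by simpa using h⟩
  choose ε hε hw using hε
  refine le_of_tendsto_of_tendsto' (b.tendsto_proj w).norm
    ((b.tendsto_proj v).norm.const_mul D) fun n ↦ ?_
  simpa only [proj_apply, hw] using hD n (fun i ↦ b.coord i v) ε hε

/-- Coefficients in `[0, 1]` increase norms by at most the unconditionality constant. -/
theorem norm_sum_smul_le {D : ℝ}
    (hD : ∀ (n : ℕ) (c ε : ℕ → ℝ), (∀ i, ε i = 1 ∨ ε i = -1) →
      ‖∑ i ∈ Finset.range n, (ε i * c i) • b i‖ ≤ D * ‖∑ i ∈ Finset.range n, c i • b i‖)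
    (n : ℕ) (a t : ℕ → ℝ) (ht : ∀ i, t i ∈ Set.Icc (0 : ℝ) 1) :
    ‖∑ i ∈ Finset.range n, (t i * a i) • b i‖ ≤ D * ‖∑ i ∈ Finset.range n, a i • b i‖ := by
  obtain ⟨g, hg, hgv⟩ := exists_dual_vector'' ℝ (∑ i ∈ Finset.range n, (t i * a i) • b i)
  -- With `g` norming the left side, these signs maximise each term, so `t i * g (a i • b i) ≤ ε i *
  -- g (a i • b i)`.
  let ε : ℕ → ℝ := fun i ↦ if 0 ≤ g (a i • b i) then 1 else -1
  have hε : ∀ i, ε i = 1 ∨ ε i = -1 := fun i ↦ by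
    by_cases h : 0 ≤ g (a i • b i)
    · exact Or.inl (if_pos h)
    · exact Or.inr (if_neg h)
  refine le_trans ?_ (hD n a ε hε)
  have hgv' : g (∑ i ∈ Finset.range n, (t i * a i) • b i) =
    ‖∑ i ∈ Finset.range n, (t i * a i) • b i‖ := hgv
  rw [← hgv']
  calc g (∑ i ∈ Finset.range n, (t i * a i) • b i)
      = ∑ i ∈ Finset.range n, t i * g (a i • b i) := by
        simp [mul_assoc]
    _ ≤ ∑ i ∈ Finset.range n, ε i * g (a i • b i) := Finset.sum_le_sum fun i _ ↦ by
        by_cases h : 0 ≤ g (a i • b i)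
        · simp only [ε, if_pos h]
          exact mul_le_mul_of_nonneg_right (ht i).2 h
        · simp only [ε, if_neg h]
          nlinarith [(ht i).1]
    _ = g (∑ i ∈ Finset.range n, (ε i * a i) • b i) := by
        simp [mul_assoc]
    _ ≤ ‖g (∑ i ∈ Finset.range n, (ε i * a i) • b i)‖ := Real.le_norm_self _
    _ ≤ 1 * ‖∑ i ∈ Finset.range n, (ε i * a i) • b i‖ := g.le_of_opNorm_le hg _
    _ = _ := one_mul _

end SchauderBasis

/-! ### Recognising copies of `ℓ₁` -/

section EllOne

variable {X : Type*} [NormedAddCommGroup X] [NormedSpace ℝ X] [CompleteSpace X]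

/-- A bounded sequence with a lower `ℓ₁`-estimate spans a copy of `ℓ₁`. -/
theorem not_containsNoCopyOfEllOne_of_sum_le {u : ℕ → X} {B K : ℝ} (hB : ∀ k, ‖u k‖ ≤ B)
    (hK : ∀ (t : ℕ → ℝ) (n : ℕ),
      ∑ k ∈ Finset.range n, |t k| ≤ K * ‖∑ k ∈ Finset.range n, t k • u k‖) :
    ¬ ContainsNoCopyOfEllOne X := by
  intro hX
  have hB0 : 0 ≤ B := (norm_nonneg _).trans (hB 0)
  have hsn : ∀ t : lp (fun _ : ℕ ↦ ℝ) 1, Summable fun k ↦ |t k| := fun t ↦ by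
    simpa using (memℓp_gen_iff (by simp)).1 (lp.memℓp t)
  have hnorm : ∀ t : lp (fun _ : ℕ ↦ ℝ) 1, ‖t‖ = ∑' k, |t k| := fun t ↦ by
    simpa using lp.norm_eq_tsum_rpow (p := 1) (by simp) t
  have hle : ∀ (t : lp (fun _ : ℕ ↦ ℝ) 1) (k : ℕ), ‖t k • u k‖ ≤ |t k| * B := fun t k ↦ by
    rw [norm_smul, Real.norm_eq_abs]
    exact mul_le_mul_of_nonneg_left (hB k) (abs_nonneg _)
  have hs : ∀ t : lp (fun _ : ℕ ↦ ℝ) 1, Summable fun k ↦ t k • u k := fun t ↦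
    Summable.of_norm_bounded ((hsn t).mul_right B) (hle t)
  let L : lp (fun _ : ℕ ↦ ℝ) 1 →ₗ[ℝ] X :=
    { toFun := fun t ↦ ∑' k, t k • u k
      map_add' := fun s t ↦ by
        rw [← (hs s).tsum_add (hs t)]
        simp [add_smul]
      map_smul' := fun c t ↦ by
        rw [RingHom.id_apply, ← (hs t).tsum_const_smul c]
        simp [mul_smul] }
  have hLb : ∀ t, ‖L t‖ ≤ B * ‖t‖ := fun t ↦ by
    rw [hnorm, mul_comm]
    exact tsum_of_norm_bounded ((hsn t).hasSum.mul_right B) (hle t)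
  have hLl : ∀ t, ‖t‖ ≤ K * ‖L t‖ := fun t ↦ by
    rw [hnorm]
    exact le_of_tendsto_of_tendsto' (hsn t).hasSum.tendsto_sum_nat
      ((hs t).hasSum.tendsto_sum_nat.norm.const_mul K) (hK t)
  have hinj : Function.Injective L := by
    refine (injective_iff_map_eq_zero L).2 fun t ht ↦ ?_
    have := hLl t
    rw [ht, norm_zero, mul_zero] at this
    exact norm_le_zero_iff.1 this
  let e : lp (fun _ : ℕ ↦ ℝ) 1 ≃L[ℝ] LinearMap.range L :=
    (LinearEquiv.ofInjective L hinj).toContinuousLinearEquivOfBounds B K hLb fun y ↦ by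
      obtain ⟨t, rfl⟩ := (LinearEquiv.ofInjective L hinj).surjective y
      rw [LinearEquiv.symm_apply_apply]
      exact hLl t
  exact (hX (LinearMap.range L)).false e.symm

end EllOne

/-! ### Shrinking bases -/

namespace SchauderBasis

variable {X : Type*} [NormedAddCommGroup X] [NormedSpace ℝ X] {b : SchauderBasis ℝ X}

/-- If a functional is not small on the tails, it is large on blocks arbitrarily far out. -/
theorem IsPremonotone.exists_block (h : b.IsPremonotone) {f : StrongDual ℝ X} {ε : ℝ}
    (n : ℕ) (hf : ε < ‖f ∘L b.tailProj n‖) :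
    ∃ (u : X) (m : ℕ), n ≤ m ∧ ‖u‖ ≤ 2 ∧ ε < f u ∧ ∀ i, b.coord i u ≠ 0 → n ≤ i ∧ i < m := by
  obtain ⟨x, hx1, hx⟩ := (f ∘L b.tailProj n).exists_lt_apply_of_lt_opNorm hf
  obtain ⟨y, hy1, hy⟩ : ∃ y : X, ‖y‖ < 1 ∧ ε < f (b.tailProj n y) := by
    rcases lt_abs.1 (show ε < |f (b.tailProj n x)| from hx) with h | h
    · exact ⟨x, hx1, h⟩
    · exact ⟨-x, by simpa using hx1, by simpa using h⟩
  have ht : Tendsto (fun m ↦ f (b.proj m (b.tailProj n y))) atTop (𝓝 (f (b.tailProj n y))) :=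
    (f.continuous.tendsto _).comp (b.tendsto_proj _)
  obtain ⟨m, hm, hnm⟩ := ((ht.eventually (lt_mem_nhds hy)).and (eventually_ge_atTop n)).exists
  refine ⟨b.proj m (b.tailProj n y), m, hnm, ?_, hm, fun i hi ↦ ?_⟩
  · linarith [h.norm_proj_apply_le m (b.tailProj n y), h n y]
  · rw [coord_proj, coord_tailProj] at hi
    split_ifs at hi with h1 h2
    · simp at hi
    · exact ⟨not_lt.1 h2, h1⟩
    · simp at hi

/-- An unconditional premonotone basis of a space without copies of `ℓ₁` is shrinking. -/
theorem IsPremonotone.tendsto_comp_tailProj [CompleteSpace X] (hpre : b.IsPremonotone)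
    (hunc : b.IsUnconditional) (hX : ContainsNoCopyOfEllOne X) (f : StrongDual ℝ X) :
    Tendsto (fun n ↦ ‖f ∘L b.tailProj n‖) atTop (𝓝 0) := by
  obtain ⟨D, hD1, hD⟩ := hunc
  have hanti : Antitone fun n ↦ ‖f ∘L b.tailProj n‖ := antitone_nat_of_succ_le fun n ↦ by
    have h1 : f ∘L b.tailProj (n + 1) = (f ∘L b.tailProj n) ∘L b.tailProj (n + 1) := by
      ext x
      simp only [ContinuousLinearMap.comp_apply, tailProj_apply, map_sub, proj_comp]
      simp
    rw [h1]
    refine (ContinuousLinearMap.opNorm_comp_le _ _).trans ?_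
    exact mul_le_of_le_one_right (norm_nonneg _) (hpre.norm_tailProj_le _)
  by_contra hnot
  obtain ⟨ε, hε, hfε⟩ : ∃ ε > 0, ∀ n, ε < ‖f ∘L b.tailProj n‖ := by
    by_contra! hcon
    refine hnot (tendsto_order.2 ⟨fun c hc ↦ Eventually.of_forall fun n ↦
      hc.trans_le (norm_nonneg _), fun c hc ↦ ?_⟩)
    obtain ⟨n, hn⟩ := hcon (c / 2) (by positivity)
    filter_upwards [eventually_ge_atTop n] with m hm
    linarith [hanti hm]
  choose u m hnm hu hfu hsupp using fun n ↦ hpre.exists_block n (hfε n)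
  -- Each block starts where the previous one may end: `u (p k)` is supported in `[p k, p (k + 1))`.
  let p : ℕ → ℕ := fun k ↦ m^[k] 0
  have hp : ∀ k, p (k + 1) = m (p k) := fun k ↦ Function.iterate_succ_apply' m k 0
  have hpm : Monotone p := monotone_nat_of_le_succ fun k ↦ by rw [hp]; exact hnm _
  have hdisj : ∀ i k l, b.coord i (u (p k)) ≠ 0 → b.coord i (u (p l)) ≠ 0 → k = l := by
    have key : ∀ i k l, k < l → b.coord i (u (p k)) ≠ 0 → b.coord i (u (p l)) ≠ 0 → False := by
      intro i k l hkl hk hl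
      have h1 := (hsupp _ i hk).2
      have h2 := (hsupp _ i hl).1
      rw [← hp] at h1
      have h3 : p (k + 1) ≤ p l := hpm hkl
      omega
    intro i k l hk hl
    rcases lt_trichotomy k l with h | h | h
    · exact (key i k l h hk hl).elim
    · exact h
    · exact (key i l k h hl hk).elim
  refine not_containsNoCopyOfEllOne_of_sum_le (u := fun k ↦ u (p k)) (B := 2)
    (K := ε⁻¹ * (‖f‖ * D)) (fun k ↦ hu _) (fun t n ↦ ?_) hX
  -- Disjoint supports let unconditionality replace `t k` by `|t k|`; then `f (u (p k)) > ε` bounds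
  -- the sum from below.
  have hvw : ‖∑ k ∈ Finset.range n, |t k| • u (p k)‖ ≤
      D * ‖∑ k ∈ Finset.range n, t k • u (p k)‖ := by
    refine norm_le_of_abs_coord_eq hD fun i ↦ ?_
    simp only [map_sum, map_smul, smul_eq_mul]
    by_cases hi : ∃ k ∈ Finset.range n, b.coord i (u (p k)) ≠ 0
    · obtain ⟨k, hk, hki⟩ := hi
      have h0 : ∀ l ∈ Finset.range n, l ≠ k → b.coord i (u (p l)) = 0 := fun l _ hl ↦
        by_contra fun h ↦ hl (hdisj i l k h hki)
      rw [Finset.sum_eq_single_of_mem k hk fun l hl hlk ↦ by rw [h0 l hl hlk, mul_zero],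
        Finset.sum_eq_single_of_mem k hk fun l hl hlk ↦ by rw [h0 l hl hlk, mul_zero]]
      simp [abs_mul]
    · push Not at hi
      rw [Finset.sum_eq_zero fun l hl ↦ by rw [hi l hl, mul_zero],
        Finset.sum_eq_zero fun l hl ↦ by rw [hi l hl, mul_zero]]
  have hsum : ε * ∑ k ∈ Finset.range n, |t k| ≤ ‖f‖ * ‖∑ k ∈ Finset.range n, |t k| • u (p k)‖ :=
    calc ε * ∑ k ∈ Finset.range n, |t k| = ∑ k ∈ Finset.range n, |t k| * ε := by
          rw [Finset.mul_sum]
          simp only [mul_comm]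
      _ ≤ ∑ k ∈ Finset.range n, |t k| * f (u (p k)) := Finset.sum_le_sum fun k _ ↦
          mul_le_mul_of_nonneg_left (hfu _).le (abs_nonneg _)
      _ = f (∑ k ∈ Finset.range n, |t k| • u (p k)) := by simp
      _ ≤ ‖f (∑ k ∈ Finset.range n, |t k| • u (p k))‖ := Real.le_norm_self _
      _ ≤ _ := f.le_opNorm _
  rw [mul_assoc, mul_assoc, le_inv_mul_iff₀ hε]
  exact hsum.trans (mul_le_mul_of_nonneg_left hvw (norm_nonneg _))

/-! ### Order intervals and bounded completeness -/

variable (b) in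
/-- The vectors whose `i`-th coordinate lies between `0` and `a i`. -/
def orderInterval (a : ℕ → ℝ) : Set X := {x | ∀ i, b.coord i x ∈ Set.uIcc 0 (a i)}

theorem zero_mem_orderInterval (a : ℕ → ℝ) : (0 : X) ∈ b.orderInterval a := fun i ↦ by
  rw [map_zero]
  exact Set.left_mem_uIcc

theorem isClosed_orderInterval (a : ℕ → ℝ) : IsClosed (b.orderInterval a) := by
  simp only [orderInterval, Set.ofPred_forall]
  exact isClosed_iInter fun i ↦ isClosed_Icc.preimage (b.coord i).continuous

theorem convex_orderInterval (a : ℕ → ℝ) : Convex ℝ (b.orderInterval a) := by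
  simp only [orderInterval, Set.ofPred_forall]
  exact convex_iInter fun i ↦ (convex_uIcc 0 (a i)).linear_preimage (b.coord i).toLinearMap

theorem norm_le_of_mem_orderInterval {D K : ℝ} (hD0 : 0 ≤ D)
    (hD : ∀ (n : ℕ) (c ε : ℕ → ℝ), (∀ i, ε i = 1 ∨ ε i = -1) →
      ‖∑ i ∈ Finset.range n, (ε i * c i) • b i‖ ≤ D * ‖∑ i ∈ Finset.range n, c i • b i‖)
    {a : ℕ → ℝ} (ha : ∀ n, ‖∑ i ∈ Finset.range n, a i • b i‖ ≤ K) {x : X}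
    (hx : x ∈ b.orderInterval a) : ‖x‖ ≤ D * K := by
  have ht : ∀ i, ∃ t ∈ Set.Icc (0 : ℝ) 1, t * a i = b.coord i x := fun i ↦ by
    have h := hx i
    rw [← segment_eq_uIcc, segment_eq_image] at h
    simpa using h
  choose t ht htx using ht
  refine norm_le_of_norm_proj_le (b := b) fun n ↦ ?_
  have h := norm_sum_smul_le hD n a t ht
  simp only [htx] at h
  rw [proj_apply]
  exact h.trans (mul_le_mul_of_nonneg_left (ha n) hD0)

variable (b) in
/-- The multiplier `∑ j, 2⁻⁽ʲ⁺¹⁾ R_j`, which multiplies the `i`-th coordinate by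
`1 - 2⁻⁽ⁱ⁺¹⁾`. -/
noncomputable def tailAverage : X →L[ℝ] X := ∑' j : ℕ, ((1 / 2 : ℝ) ^ (j + 1)) • b.tailProj j

theorem hasSum_half_pow_succ : HasSum (fun j : ℕ ↦ (1 / 2 : ℝ) ^ (j + 1)) 1 := by
  simpa [pow_succ] using hasSum_geometric_two.mul_right (1 / 2 : ℝ)

theorem IsPremonotone.norm_term_le (h : b.IsPremonotone) (j : ℕ) :
    ‖((1 / 2 : ℝ) ^ (j + 1)) • b.tailProj j‖ ≤ (1 / 2 : ℝ) ^ (j + 1) := by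
  rw [norm_smul, Real.norm_of_nonneg (by positivity)]
  exact mul_le_of_le_one_right (by positivity) (h.norm_tailProj_le j)

/-- The weights sum to `1` and each tail projection has norm at most `1`. -/
theorem IsPremonotone.norm_tailAverage_le (h : b.IsPremonotone) : ‖b.tailAverage‖ ≤ 1 :=
  tsum_of_norm_bounded hasSum_half_pow_succ h.norm_term_le

theorem sum_half_pow_succ (n : ℕ) :
    ∑ j ∈ Finset.range n, (1 / 2 : ℝ) ^ (j + 1) = 1 - (1 / 2) ^ n := by
  induction n with
  | zero => simp
  | succ n ih => rw [Finset.sum_range_succ, ih]; ring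

theorem IsPremonotone.coord_tailAverage [CompleteSpace X] (h : b.IsPremonotone) (i : ℕ) (x : X) :
    b.coord i (b.tailAverage x) = (1 - (1 / 2) ^ (i + 1)) * b.coord i x := by
  have hs : Summable fun j : ℕ ↦ ((1 / 2 : ℝ) ^ (j + 1)) • b.tailProj j :=
    Summable.of_norm_bounded hasSum_half_pow_succ.summable h.norm_term_le
  have h1 := (hs.hasSum.mapL (ContinuousLinearMap.apply ℝ X x)).mapL (b.coord i)
  refine h1.unique ?_
  rw [← sum_half_pow_succ, Finset.sum_mul]
  -- Only `R_j` with `j ≤ i` retain coordinate `i`, so the series is a finite geometric sum.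
  convert hasSum_sum_of_ne_finset_zero (s := Finset.range (i + 1)) (L := .unconditional ℕ) ?_ using 1
  · refine Finset.sum_congr rfl fun j hj ↦ ?_
    have : ¬ i < j := by simp at hj; omega
    simp [coord_tailProj, this]
  · intro j hj
    have : i < j := by simp at hj; omega
    simp [coord_tailProj, this]

/-- If order intervals have the fixed point property, then a premonotone basis is
boundedly complete. -/
theorem IsPremonotone.exists_coord_eq [CompleteSpace X] (h : b.IsPremonotone) {a : ℕ → ℝ} {K : ℝ}
    (ha : ∀ n, ‖∑ i ∈ Finset.range n, a i • b i‖ ≤ K) (hfpp : HasAffineFPP (b.orderInterval a)) :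
    ∃ x : X, ∀ i, b.coord i x = a i := by
  have hle : ∀ i, ‖(1 / 2 : ℝ) ^ (i + 1) • a i • b i‖ ≤ (1 / 2 : ℝ) ^ (i + 1) * (2 * K) :=
    fun i ↦ by
      rw [norm_smul, Real.norm_of_nonneg (by positivity)]
      refine mul_le_mul_of_nonneg_left ?_ (by positivity)
      have h1 : a i • b i = ∑ j ∈ Finset.range (i + 1), a j • b j -
          ∑ j ∈ Finset.range i, a j • b j := by
        rw [Finset.sum_range_succ]; abel
      rw [h1]
      linarith [norm_sub_le (∑ j ∈ Finset.range (i + 1), a j • b j)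
        (∑ j ∈ Finset.range i, a j • b j), ha (i + 1), ha i]
  have hs : Summable fun i ↦ (1 / 2 : ℝ) ^ (i + 1) • a i • b i :=
    Summable.of_norm_bounded (hasSum_half_pow_succ.summable.mul_right _) hle
  let w : X := ∑' i, (1 / 2 : ℝ) ^ (i + 1) • a i • b i
  have hw : ∀ i, b.coord i w = (1 / 2) ^ (i + 1) * a i := fun i ↦ by
    refine (hs.hasSum.mapL (b.coord i)).unique ?_
    convert hasSum_single i ?_ using 1
    · simp [coord_basis]
    · intro j hj
      simp [coord_basis, hj.symm]
  have hT : ∀ i x, b.coord i (b.tailAverage x + w) =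
      (1 - (1 / 2) ^ (i + 1)) * b.coord i x + (1 / 2) ^ (i + 1) * a i := fun i x ↦ by
    rw [map_add, h.coord_tailAverage, hw]
  obtain ⟨x, -, hx⟩ := hfpp (fun x ↦ b.tailAverage x + w)
    (fun x hx i ↦ by
      have hp : (1 / 2 : ℝ) ^ (i + 1) ≤ 1 := pow_le_one₀ (by norm_num) (by norm_num)
      rw [hT]
      -- Each new coordinate is a convex combination of the old one and `a i`.
      exact convex_uIcc 0 (a i) (hx i) Set.right_mem_uIcc (sub_nonneg.2 hp) (by positivity)
        (by ring))
    (LipschitzWith.lipschitzOnWith (LipschitzWith.of_dist_le_mul fun x y ↦ by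
      rw [dist_add_right, dist_eq_norm, ← map_sub, dist_eq_norm, NNReal.coe_one]
      exact b.tailAverage.le_of_opNorm_le h.norm_tailAverage_le _))
    (fun x _ y _ t _ ↦ by
      simp only [map_add, map_smul]
      module)
  refine ⟨x, fun i ↦ ?_⟩
  have h1 := hT i x
  rw [hx] at h1
  have h2 : (0 : ℝ) < (1 / 2) ^ (i + 1) := by positivity
  exact mul_left_cancel₀ h2.ne' (by linarith)

/-! ### Reflexivity by James' criterion -/

theorem IsPremonotone.isReflexiveSpace [CompleteSpace X] (hpre : b.IsPremonotone) (hunc : b.IsUnconditional)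
    (hX : ContainsNoCopyOfEllOne X)
    (hfpp : ∀ C : Set X, C.Nonempty → C ⊆ Metric.closedBall (0 : X) 1 → IsClosed C → Convex ℝ C →
      HasAffineFPP C) : IsReflexiveSpace X := by
  intro φ
  have hshr := hpre.tendsto_comp_tailProj hunc hX
  obtain ⟨D, hD1, hD⟩ := hunc
  have hφ : ∀ (f : StrongDual ℝ X) (n : ℕ), φ (f ∘L b.proj n) =
      f (∑ i ∈ Finset.range n, φ (b.coord i) • b i) := fun f n ↦ by
    have h1 : f ∘L b.proj n = ∑ i ∈ Finset.range n, f (b i) • b.coord i := by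
      ext x
      simp [mul_comm]
    rw [h1]
    simp [mul_comm]
  have hbd : ∀ n, ‖∑ i ∈ Finset.range n, φ (b.coord i) • b i‖ ≤ 2 * ‖φ‖ := fun n ↦ by
    refine NormedSpace.norm_le_dual_bound ℝ _ (by positivity) fun f ↦ ?_
    rw [← hφ]
    have h2 : ‖f ∘L b.proj n‖ ≤ ‖f‖ * 2 := (f.opNorm_comp_le _).trans <|
      mul_le_mul_of_nonneg_left (ContinuousLinearMap.opNorm_le_bound _ zero_le_two
        (hpre.norm_proj_apply_le n)) (norm_nonneg _)
    calc ‖φ (f ∘L b.proj n)‖ ≤ ‖φ‖ * (‖f‖ * 2) := φ.le_opNorm_of_le h2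
      _ = 2 * ‖φ‖ * ‖f‖ := by ring
  -- Scaling by `c` puts the order interval inside the unit ball; the `+ 1` below avoids dividing by
  -- zero when `φ = 0`.
  obtain ⟨c, hc0, hc⟩ : ∃ c : ℝ, 0 < c ∧ D * (c * (2 * ‖φ‖)) ≤ 1 := by
    have hpos : 0 < D * (2 * ‖φ‖) + 1 := by positivity
    refine ⟨(D * (2 * ‖φ‖) + 1)⁻¹, inv_pos.2 hpos, ?_⟩
    rw [mul_left_comm, inv_mul_le_iff₀ hpos]
    linarith
  have hcbd : ∀ n, ‖∑ i ∈ Finset.range n, (c * φ (b.coord i)) • b i‖ ≤ c * (2 * ‖φ‖) :=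
    fun n ↦ by
      simp only [mul_smul, ← Finset.smul_sum, norm_smul, Real.norm_of_nonneg hc0.le]
      exact mul_le_mul_of_nonneg_left (hbd n) hc0.le
  obtain ⟨x, hx⟩ := hpre.exists_coord_eq hcbd <|
    hfpp _ ⟨0, zero_mem_orderInterval _⟩
      (fun x hx ↦ mem_closedBall_zero_iff.2
        ((norm_le_of_mem_orderInterval (by linarith) hD hcbd hx).trans hc))
      (isClosed_orderInterval _) (convex_orderInterval _)
  refine ⟨c⁻¹ • x, ContinuousLinearMap.ext fun f ↦ ?_⟩
  have hy : ∀ n, b.proj n (c⁻¹ • x) = ∑ i ∈ Finset.range n, φ (b.coord i) • b i := fun n ↦ by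
    rw [proj_apply]
    refine Finset.sum_congr rfl fun i _ ↦ ?_
    rw [map_smul, hx, smul_eq_mul, inv_mul_cancel_left₀ hc0.ne']
  have h1 : Tendsto (fun n ↦ φ (f ∘L b.proj n)) atTop (𝓝 (f (c⁻¹ • x))) := by
    simp only [hφ, ← hy]
    exact (f.continuous.tendsto _).comp (b.tendsto_proj _)
  -- Shrinking makes `f ∘ P_n` converge to `f` in norm, so `φ` is determined by its values on the
  -- coordinate functionals.
  have h2 : Tendsto (fun n ↦ f ∘L b.proj n) atTop (𝓝 f) := by
    refine tendsto_iff_norm_sub_tendsto_zero.2 ((hshr f).congr fun n ↦ ?_)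
    rw [← norm_neg]
    congr 1
    ext x
    simp [tailProj_apply]
  exact tendsto_nhds_unique h1 ((φ.continuous.tendsto _).comp h2)

end SchauderBasis

theorem mainTheorem7 {X : Type*} [NormedAddCommGroup X] [NormedSpace ℝ X] [CompleteSpace X]
    (b : SchauderBasis ℝ X) (hpre : b.IsPremonotone) (hunc : b.IsUnconditional)
    (hl1 : ContainsNoCopyOfEllOne X) :
    List.TFAE [
      IsReflexiveSpace X,
      SpaceHasAffineFPP X,
      ∀ C : Set X, C.Nonempty → C ⊆ Metric.closedBall (0 : X) 1 → IsClosed C → Convex ℝ C →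
        HasAffineFPP C] := by
  tfae_have 1 → 2 := fun h ↦ h.spaceHasAffineFPP
  tfae_have 2 → 3 := fun h C hne hC hcl hcv ↦
    h C hne hcl (Metric.isBounded_closedBall.subset hC) hcv
  tfae_have 3 → 1 := hpre.isReflexiveSpace hunc hl1
  tfae_finish
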